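/- Let $X$ be a discrete memoryless source with finite alphabet $\mathcal X$ and distribution $P_X$, let $\mathcal U$ be a finite reconstruction alphabet, and let $d\colon \mathcal X\times\mathcal U\to[0,\infty)$ be a distortion measure, extended additively to sequences by $\hat d(x^n,u^n)=\frac1n\sum_{t=1}^n d(x_t,u_t)$. Let $p_1,\dots,p_k$ be (not necessarily distinct) primes with $\prod_{i=1}^k p_i\ge|\mathcal U|$, and let $D$ be such that some conditional distribution $P_{U|X}$ on $\mathcal U$ satisfies $\mathbb E\,d(X,U)\le D$. Logarithms and entropies are to base $2$. Then $\mathcal U$ embeds in the group $A=\bigoplus_{i=1}^k\mathbb Z_{p_i}$, the minimum $$R_0=\min_{P_{U|X}:\ \mathbb E\,d(X,U)\le D}\Big(\sum_{i=1}^k\log p_i\Big)-H(U|X)$$ exists, and for every embedding of $\mathcal U$ as a subset of $A$ every rate $R\ge R_0$ is achievable at distortion $D$ with group codes over $A$: for every $\epsilon>0$ and all sufficiently large $n$ there are linear codes $\mathcal C_i\subseteq\mathbb Z_{p_i}^n$, $1\le i\le k$, such that the group code $\mathcal C\le A^n$ consisting of all sequences whose $i$-th digits form a word of $\mathcal C_i$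 for each $i$ satisfies $$\tfrac1n\log|\mathcal C|\le R+\epsilon,$$ and an encoder $f\colon\mathcal X^n\to\mathcal C\cap\mathcal U^n$, whose output is used as the reconstruction, with $$\mathbb E\,\hat d\big(X^n,f(X^n)\big)\le D+\epsilon .$$ -/

import Mathlib

open scoped BigOperators

noncomputable section

namespace GroupSourceCoding

/-- The conditional entropy `H(U|X)`, in bits, of the output `U` of the channel `W = P_{U|X}`
driven by the source distribution `P = P_X`, that is `∑ x, P(x) H(W(·|x))`. -/
def condEntropy {X U : Type*} [Fintype X] [Fintype U] (P : X → ℝ) (W : X → U → ℝ) : ℝ :=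
  ∑ x, P x * ∑ u, Real.negMulLog (W x u) / Real.log 2

/-- The single-letter expected distortion `E d(X,U)` under the joint law `P_X P_{U|X}`. -/
def expDistortion {X U : Type*} [Fintype X] [Fintype U] (P : X → ℝ) (d : X → U → ℝ)
    (W : X → U → ℝ) : ℝ :=
  ∑ x, ∑ u, P x * W x u * d x u

/-- The admissible test channels: all conditional distributions `W = P_{U|X}`
with `E d(X,U) ≤ D`. -/
def admissible {X U : Type*} [Fintype X] [Fintype U] (P : X → ℝ) (d : X → U → ℝ) (D : ℝ) :
    Set (X → U → ℝ) :=
  {W | (∀ x, W x ∈ stdSimplex ℝ U) ∧ expDistortion P d W ≤ D}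

/-- The quantity `(∑ i, log p_i) - H(U|X)`, in bits. -/
def groupRate {X U : Type*} [Fintype X] [Fintype U] {k : ℕ} (p : Fin k → ℕ)
    (P : X → ℝ) (W : X → U → ℝ) : ℝ :=
  (∑ i, Real.logb 2 (p i)) - condEntropy P W

/-- The group code of blocklength `n` over `⊕ ℤ/p_i` whose `i`-th digit plane is the linear code
`C i` over `ℤ/p_i`: the sequences `c` with `(c_{1,i}, …, c_{n,i}) ∈ C i` for each digit `i`. -/
def codebook {k n : ℕ} {p : Fin k → ℕ}
    (C : ∀ i, Submodule (ZMod (p i)) (Fin n → ZMod (p i))) :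
    AddSubgroup (Fin n → ∀ i, ZMod (p i)) where
  carrier := {c | ∀ i, (fun t => c t i) ∈ C i}
  add_mem' ha hb i := (C i).add_mem (ha i) (hb i)
  zero_mem' i := (C i).zero_mem
  neg_mem' ha i := (C i).neg_mem (ha i)

/-- A point-to-point lossy coding scheme of blocklength `n` based on a group code over `⊕ ℤ/p_i`,
where `S` presents the reconstruction alphabet `U` as a subset of `⊕ ℤ/p_i`. The encoder sends
a codeword of the group code, and this codeword, read as a sequence over `U`, is the
reconstruction. -/
structure GroupScheme (X : Type*) {U : Type*} {k : ℕ} {p : Fin k → ℕ}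
    (S : U ↪ (∀ i, ZMod (p i))) (n : ℕ) where
  /-- the linear code used for each digit -/
  digitCode : ∀ i, Submodule (ZMod (p i)) (Fin n → ZMod (p i))
  /-- the encoder -/
  enc : (Fin n → X) → codebook digitCode
  /-- the decoder -/
  dec : codebook digitCode → (Fin n → U)
  /-- the reconstruction of a source sequence is the transmitted codeword itself -/
  dec_enc : ∀ x t, S (dec (enc x) t) = (enc x : Fin n → ∀ i, ZMod (p i)) t

/-- The rate `(1/n) log |C|`, in bits per source sample, of a scheme with group code `C`. -/
def GroupScheme.rate {X U : Type*} {k : ℕ} {p : Fin k → ℕ} {S : U ↪ (∀ i, ZMod (p i))} {n : ℕ}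
    (c : GroupScheme X S n) : ℝ :=
  Real.logb 2 (Nat.card (codebook c.digitCode)) / n

/-- The expected per-letter distortion of a scheme when the source sequence is drawn from the
product distribution `P^n`. -/
def GroupScheme.distortion {X U : Type*} [Fintype X] {k : ℕ} {p : Fin k → ℕ}
    {S : U ↪ (∀ i, ZMod (p i))} {n : ℕ} (c : GroupScheme X S n) (P : X → ℝ) (d : X → U → ℝ) : ℝ :=
  ∑ x : Fin n → X, (∏ t, P (x t)) * ((∑ t, d (x t) (c.dec (c.enc x) t)) / n)

/-- The pair `(R, D)` is achievable with group codes over `⊕ ℤ/p_i`, the reconstruction alphabet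
being embedded by `S`. -/
def Achievable {X U : Type*} [Fintype X] {k : ℕ} {p : Fin k → ℕ} (S : U ↪ (∀ i, ZMod (p i)))
    (P : X → ℝ) (d : X → U → ℝ) (R D : ℝ) : Prop :=
  ∀ ε : ℝ, 0 < ε → ∃ N : ℕ, ∀ n : ℕ, N ≤ n →
    ∃ c : GroupScheme X S n, c.rate ≤ R + ε ∧ c.distortion P d ≤ D + ε

end GroupSourceCoding

end

/-! A test channel and an embedding give a joint law `Q` on source letters and group elements, zero
off the image of `U`. The core is a soft-covering statement: some group code carries nonnegative
word weights `τ` for which `∑ u, τ u * Q^n(x,u)` is close to `P^n(x)` in total absolute deviation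
over `x`, while the `τ`-weighted total of a prescribed cost is almost no larger than its plain
total.

Over one field `ZMod p`, a random affine code has uniform, pairwise independent words, so a
second-moment bound suffices (`IsPairwiseUniform.exists_codeSum_le`). The variance is small because,
up to exponentially small mass, the conditional probability of a word is at most `exp (-n(H-δ))`
(`exists_rate_atypical`); any rate above `log p - H` then works (`exists_linear_covering`).

Pairwise independence uses division, so a general group is treated digit by digit. The later digits
are covered in the context of source and first digit, and the resulting error becomes part of the
cost imposed on the first digit's code (`Covers.cons`). This is why coverings carry an arbitrary
cost. The chain rule adds the rates up to `∑ log p_i - H`.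

With distortion as the cost, a minimum-distortion encoder does at least as well as the `τ`-weighted
average (`exists_groupScheme`). The minimum of the rate exists by compactness and continuity. -/

namespace GroupSourceCoding

/-! ### Exponential tail bound -/

section Chernoff

/-- A finite-alphabet Chernoff bound: the empirical mean of a function with negative mean is
nonnegative only with exponentially small probability. -/
theorem exists_chernoff_rate {I : Type*} [Fintype I] (q : I → ℝ) (hq : ∀ i, 0 ≤ q i)
    (hq1 : ∑ i, q i = 1) (f : I → ℝ) (hf : ∑ i, q i * f i < 0) :
    ∃ ρ : ℝ, 0 ≤ ρ ∧ ρ < 1 ∧ ∀ (n : ℕ) (B : Finset (Fin n → I)),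
      (∀ i ∈ B, 0 ≤ ∑ t, f (i t)) → ∑ i ∈ B, ∏ t, q (i t) ≤ ρ ^ n := by
  have hder : HasDerivAt (fun s : ℝ => ∑ i, q i * Real.exp (s * f i)) (∑ i, q i * f i) 0 := by
    have h : ∀ i ∈ (Finset.univ : Finset I),
        HasDerivAt (fun s : ℝ => q i * Real.exp (s * f i)) (q i * f i) 0 := by
      intro i _
      have := (((hasDerivAt_id (0 : ℝ)).mul_const (f i)).exp).const_mul (q i)
      simpa using this
    simpa using HasDerivAt.fun_sum h
  -- The moment generating function equals 1 at 0 with negative slope, so it drops below 1 just to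
  -- the right.
  obtain ⟨s, hs0, hs⟩ : ∃ s : ℝ, 0 < s ∧ ∑ i, q i * Real.exp (s * f i) < 1 := by
    have h1 := hder.hasDerivWithinAt (s := Set.Ioi 0)
    rw [hasDerivWithinAt_iff_tendsto_slope' (by simp)] at h1
    have h2 := (h1.eventually (gt_mem_nhds hf)).and self_mem_nhdsWithin
    obtain ⟨s, hs, hs0⟩ := h2.exists
    refine ⟨s, hs0, ?_⟩
    have hs0' : (0 : ℝ) < s := hs0
    rw [slope_def_field] at hs
    simp only [zero_mul, Real.exp_zero, mul_one, hq1, sub_zero] at hs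
    rw [div_lt_iff₀ hs0'] at hs
    linarith
  refine ⟨_, Finset.sum_nonneg fun i _ => mul_nonneg (hq i) (Real.exp_pos _).le, hs, ?_⟩
  intro n B hB
  have hpos : ∀ i : Fin n → I, 0 ≤ ∏ t, q (i t) := fun i => Finset.prod_nonneg fun t _ => hq _
  calc ∑ i ∈ B, ∏ t, q (i t)
      ≤ ∑ i ∈ B, (∏ t, q (i t)) * Real.exp (s * ∑ t, f (i t)) := by
        refine Finset.sum_le_sum fun i hi => le_mul_of_one_le_right (hpos i) ?_
        exact Real.one_le_exp (mul_nonneg hs0.le (hB i hi))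
    _ ≤ ∑ i : Fin n → I, (∏ t, q (i t)) * Real.exp (s * ∑ t, f (i t)) :=
        Finset.sum_le_sum_of_subset_of_nonneg (Finset.subset_univ _)
          fun i _ _ => mul_nonneg (hpos i) (Real.exp_pos _).le
    _ = ∑ i : Fin n → I, ∏ t, (q (i t) * Real.exp (s * f (i t))) := by
        refine Finset.sum_congr rfl fun i _ => ?_
        rw [Finset.prod_mul_distrib, Finset.mul_sum, Real.exp_sum]
    _ = (∑ i, q i * Real.exp (s * f i)) ^ n := by
        rw [← Fintype.piFinset_univ, Finset.sum_prod_piFinset Finset.univ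
          (fun (_ : Fin n) i => q i * Real.exp (s * f i))]
        simp

end Chernoff

/-! ### Second-moment estimates for pairwise independent codebooks -/

section PairwiseIndependence

variable {V Ω B : Type*} [Fintype V] [Fintype Ω] [Fintype B]

/-- A random codebook `c ω : B → V`, with seed `ω` uniform on `Ω`, whose codewords are uniformly
distributed and pairwise independent. -/
structure IsPairwiseUniform (c : Ω → B → V) : Prop where
  uniform : ∀ b (f : V → ℝ),
    (Fintype.card V : ℝ) * ∑ ω, f (c ω b) = Fintype.card Ω * ∑ v, f v
  pairwise : ∀ b b', b ≠ b' → ∀ f g : V → ℝ,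
    (Fintype.card V : ℝ) ^ 2 * ∑ ω, f (c ω b) * g (c ω b') =
      Fintype.card Ω * ((∑ v, f v) * ∑ v, g v)

/-- The normalized sum of `f` over the codebook `c ω`, an estimate of `∑ v, f v`. -/
noncomputable def codeSum {V Ω B : Type*} [Fintype V] [Fintype B] (c : Ω → B → V) (ω : Ω) (f : V → ℝ) : ℝ :=
  (Fintype.card V : ℝ) / Fintype.card B * ∑ b, f (c ω b)

theorem codeSum_nonneg {V Ω B : Type*} [Fintype V] [Fintype B] (c : Ω → B → V) (ω : Ω) {f : V → ℝ} (hf : ∀ v, 0 ≤ f v) :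
    0 ≤ codeSum c ω f :=
  mul_nonneg (by positivity) (Finset.sum_nonneg fun _ _ => hf _)

theorem codeSum_add {V Ω B : Type*} [Fintype V] [Fintype B] (c : Ω → B → V) (ω : Ω) (f g : V → ℝ) :
    codeSum c ω (fun v => f v + g v) = codeSum c ω f + codeSum c ω g := by
  simp only [codeSum, Finset.sum_add_distrib, mul_add]

theorem IsPairwiseUniform.sum_codeSum [Nonempty B] {c : Ω → B → V} (hc : IsPairwiseUniform c) (f : V → ℝ) :
    ∑ ω, codeSum c ω f = Fintype.card Ω * ∑ v, f v := by
  have hB : (Fintype.card B : ℝ) ≠ 0 := by simp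
  simp only [codeSum]
  rw [← Finset.mul_sum, Finset.sum_comm, div_mul_eq_mul_div, Finset.mul_sum]
  simp only [hc.uniform, Finset.sum_const, Finset.card_univ, nsmul_eq_mul]
  field_simp

/-- Off-diagonal pairs of messages reproduce the squared mean, so only the diagonal contributes to
the variance. -/
theorem IsPairwiseUniform.sum_codeSum_sq_le [Nonempty V] [Nonempty B] {c : Ω → B → V}
    (hc : IsPairwiseUniform c)
    (f : V → ℝ) :
    ∑ ω, (codeSum c ω f - ∑ v, f v) ^ 2 ≤
      Fintype.card Ω * ((Fintype.card V : ℝ) / Fintype.card B * ∑ v, f v ^ 2) := by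
  classical
  have hB : (Fintype.card B : ℝ) ≠ 0 := by simp
  have hV : (Fintype.card V : ℝ) ≠ 0 := by simp
  set s := ∑ v, f v with hs
  have hdiag : ∀ b, ∑ ω, f (c ω b) * f (c ω b) =
      Fintype.card Ω / Fintype.card V * ∑ v, f v ^ 2 := by
    intro b
    have := hc.uniform b (fun v => f v * f v)
    field_simp
    simp only [pow_two] at *
    linarith
  have hoff : ∀ b b', b ≠ b' → ∑ ω, f (c ω b) * f (c ω b') =
      Fintype.card Ω / (Fintype.card V : ℝ) ^ 2 * s ^ 2 := by
    intro b b' h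
    have := hc.pairwise b b' h f f
    field_simp
    simp only [pow_two] at *
    linarith
  -- The off-diagonal value is also granted to diagonal pairs, so that the total over all pairs
  -- cancels the squared mean exactly.
  have hle : ∀ b b', ∑ ω, f (c ω b) * f (c ω b') ≤
      Fintype.card Ω / (Fintype.card V : ℝ) ^ 2 * s ^ 2 +
        if b = b' then Fintype.card Ω / (Fintype.card V : ℝ) * ∑ v, f v ^ 2 else 0 := by
    intro b b'
    split_ifs with h
    · subst h
      rw [hdiag]
      have : (0 : ℝ) ≤ Fintype.card Ω / (Fintype.card V : ℝ) ^ 2 * s ^ 2 := by positivity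
      linarith
    · rw [hoff b b' h, add_zero]
  have hsq : ∑ ω, (∑ b, f (c ω b)) ^ 2 ≤
      (Fintype.card B : ℝ) ^ 2 * (Fintype.card Ω / (Fintype.card V : ℝ) ^ 2 * s ^ 2) +
        Fintype.card B * (Fintype.card Ω / (Fintype.card V : ℝ) * ∑ v, f v ^ 2) := by
    calc ∑ ω, (∑ b, f (c ω b)) ^ 2 = ∑ b, ∑ b', ∑ ω, f (c ω b) * f (c ω b') := by
          simp only [pow_two, Finset.sum_mul_sum]
          rw [Finset.sum_comm]
          exact Finset.sum_congr rfl fun b _ => Finset.sum_comm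
      _ ≤ _ := Finset.sum_le_sum fun b _ => Finset.sum_le_sum fun b' _ => hle b b'
      _ = _ := by
          simp only [Finset.sum_add_distrib, Finset.sum_ite_eq, Finset.mem_univ, if_true,
            Finset.sum_const, Finset.card_univ, nsmul_eq_mul]
          ring
  have hexp : ∑ ω, (codeSum c ω f - s) ^ 2 =
      ((Fintype.card V : ℝ) / Fintype.card B) ^ 2 * ∑ ω, (∑ b, f (c ω b)) ^ 2
        - Fintype.card Ω * s ^ 2 := by
    have h1 : ∀ ω, (codeSum c ω f - s) ^ 2 =
        ((Fintype.card V : ℝ) / Fintype.card B) ^ 2 * (∑ b, f (c ω b)) ^ 2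
          - 2 * s * codeSum c ω f + s ^ 2 := by
      intro ω
      simp only [codeSum]
      ring
    simp only [h1, Finset.sum_add_distrib, Finset.sum_sub_distrib, ← Finset.mul_sum,
      hc.sum_codeSum, ← hs, Finset.sum_const, Finset.card_univ, nsmul_eq_mul]
    ring
  rw [hexp]
  have := mul_le_mul_of_nonneg_left hsq
    (by positivity : 0 ≤ ((Fintype.card V : ℝ) / Fintype.card B) ^ 2)
  have he : ((Fintype.card V : ℝ) / Fintype.card B) ^ 2 * ((Fintype.card B : ℝ) ^ 2 *
      (Fintype.card Ω / (Fintype.card V : ℝ) ^ 2 * s ^ 2) +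
        Fintype.card B * (Fintype.card Ω / (Fintype.card V : ℝ) * ∑ v, f v ^ 2)) =
      Fintype.card Ω * s ^ 2 +
        Fintype.card Ω * ((Fintype.card V : ℝ) / Fintype.card B * ∑ v, f v ^ 2) := by
    field_simp
  linarith

/-- The mean deviation of the code sum of a function that splits into a part `f` bounded by `K`
and a remainder `r`. -/
theorem IsPairwiseUniform.sum_abs_codeSum_sub_le [Nonempty V] [Nonempty B] {c : Ω → B → V}
    (hc : IsPairwiseUniform c)
    {f r : V → ℝ} (hf : ∀ v, 0 ≤ f v) (hr : ∀ v, 0 ≤ r v) {K m : ℝ} (hfK : ∀ v, f v ≤ K * m)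
    (hK : 0 ≤ K) (hfm : ∑ v, f v ≤ m) :
    ∑ ω, |codeSum c ω (fun v => f v + r v) - ∑ v, (f v + r v)| ≤
      Fintype.card Ω * (m * √((Fintype.card V : ℝ) / Fintype.card B * K) + 2 * ∑ v, r v) := by
  have hm : 0 ≤ m := (Finset.sum_nonneg fun v _ => hf v).trans hfm
  have hfsq : ∑ v, f v ^ 2 ≤ K * m ^ 2 := by
    calc ∑ v, f v ^ 2 ≤ ∑ v, K * m * f v := by
          refine Finset.sum_le_sum fun v _ => ?_
          rw [pow_two]
          exact mul_le_mul_of_nonneg_right (hfK v) (hf v)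
      _ = K * m * ∑ v, f v := by rw [Finset.mul_sum]
      _ ≤ K * m * m := mul_le_mul_of_nonneg_left hfm (mul_nonneg hK hm)
      _ = K * m ^ 2 := by ring
  -- The bounded part: Cauchy–Schwarz over the seeds and the variance bound.
  have h1 : ∑ ω, |codeSum c ω f - ∑ v, f v| ≤
      Fintype.card Ω * (m * √((Fintype.card V : ℝ) / Fintype.card B * K)) := by
    refine abs_le_of_sq_le_sq' ?_ (by positivity) |>.2
    calc (∑ ω, |codeSum c ω f - ∑ v, f v|) ^ 2
        ≤ Fintype.card Ω * ∑ ω, |codeSum c ω f - ∑ v, f v| ^ 2 := by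
          simpa using sq_sum_le_card_mul_sum_sq (s := Finset.univ)
            (f := fun ω => |codeSum c ω f - ∑ v, f v|)
      _ ≤ Fintype.card Ω * (Fintype.card Ω *
            ((Fintype.card V : ℝ) / Fintype.card B * (K * m ^ 2))) := by
          simp only [sq_abs]
          refine mul_le_mul_of_nonneg_left ((hc.sum_codeSum_sq_le f).trans ?_) (by positivity)
          gcongr
      _ = _ := by
          rw [mul_pow, mul_pow, Real.sq_sqrt (by positivity)]
          ring
  -- The remainder has no useful sup bound but small mass, so first moments are enough.
  have h2 : ∑ ω, |codeSum c ω r - ∑ v, r v| ≤ Fintype.card Ω * (2 * ∑ v, r v) := by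
    calc ∑ ω, |codeSum c ω r - ∑ v, r v| ≤ ∑ ω, (codeSum c ω r + ∑ v, r v) := by
          refine Finset.sum_le_sum fun ω _ => (abs_sub _ _).trans ?_
          rw [abs_of_nonneg (codeSum_nonneg c ω hr),
            abs_of_nonneg (Finset.sum_nonneg fun v _ => hr v)]
      _ = _ := by
          rw [Finset.sum_add_distrib, hc.sum_codeSum]
          simp
          ring
  calc ∑ ω, |codeSum c ω (fun v => f v + r v) - ∑ v, (f v + r v)|
      ≤ ∑ ω, (|codeSum c ω f - ∑ v, f v| + |codeSum c ω r - ∑ v, r v|) := by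
        refine Finset.sum_le_sum fun ω _ => ?_
        rw [codeSum_add, Finset.sum_add_distrib, add_sub_add_comm]
        exact abs_add_le _ _
    _ ≤ _ := by
        rw [Finset.sum_add_distrib, mul_add]
        exact add_le_add h1 h2

end PairwiseIndependence

/-! ### Random affine codes over a field -/

section LinearCode

variable {F V : Type*} [Field F] [AddCommGroup V] [Module F V] [Fintype V] {κ : ℕ}

/-- The codeword `g₀ + ∑ j, b j • G j` of the message `b`, for the seed `(G, g₀)`. -/
def linearWord {F V : Type*} [Field F] [AddCommGroup V] [Module F V] {κ : ℕ}
    (ω : (Fin κ → V) × V) (b : Fin κ → F) : V :=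
  ω.2 + ∑ j, b j • ω.1 j

/-- The uniform shift makes each word uniform; the difference of two words is a nonzero linear
combination of the generators, hence uniform and independent of the first word. -/
theorem isPairwiseUniform_linearWord :
    IsPairwiseUniform (linearWord : (Fin κ → V) × V → (Fin κ → F) → V) where
  uniform b f := by
    simp only [linearWord, Fintype.sum_prod_type]
    have : ∀ G : Fin κ → V, ∑ v, f (v + ∑ j, b j • G j) = ∑ v, f v := fun G =>
      Equiv.sum_comp (Equiv.addRight (∑ j, b j • G j)) f
    simp only [this, Finset.sum_const, Finset.card_univ, nsmul_eq_mul, Fintype.card_prod]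
    push_cast
    ring
  pairwise b b' hb f g := by
    obtain ⟨j₀, hj₀⟩ := Function.ne_iff.mp hb
    set φ : (Fin κ → V) → V := fun G => ∑ j, (b' j - b j) • G j with hφ
    have hshift : ∀ G : Fin κ → V, ∑ v, f (v + ∑ j, b j • G j) * g (v + ∑ j, b' j • G j) =
        ∑ v, f v * g (v + φ G) := by
      intro G
      rw [← Equiv.sum_comp (Equiv.addRight (∑ j, b j • G j)) (fun v => f v * g (v + φ G))]
      refine Finset.sum_congr rfl fun v _ => ?_
      simp only [hφ, Equiv.coe_addRight, sub_smul, Finset.sum_sub_distrib]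
      congr 2
      abel
    -- Messages differ at `j₀`, and the difference is invertible: moving the generator `j₀` moves
    -- `φ` by any prescribed vector, so all fibres of `φ` have equal size.
    have hsec : ∀ (G : Fin κ → V) (v : V), φ (G + Pi.single j₀ ((b' j₀ - b j₀)⁻¹ • v)) = φ G + v := by
      intro G v
      simp only [hφ, Pi.add_apply, smul_add, Finset.sum_add_distrib]
      congr 1
      rw [Finset.sum_eq_single j₀]
      · rw [Pi.single_eq_same, smul_smul, mul_inv_cancel₀ (sub_ne_zero.mpr hj₀.symm), one_smul]
      · intro j _ hj
        rw [Pi.single_eq_of_ne hj, smul_zero]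
      · simp
    have hfib : ∀ w : V → ℝ, (Fintype.card V : ℝ) * ∑ G, w (φ G) =
        Fintype.card (Fin κ → V) * ∑ v, w v := by
      intro w
      have htrans : ∀ H : Fin κ → V, ∑ G : Fin κ → V, w (φ (G + H)) = ∑ G, w (φ G) := fun H =>
        Equiv.sum_comp (Equiv.addRight H) (fun G => w (φ G))
      calc (Fintype.card V : ℝ) * ∑ G, w (φ G)
          = ∑ v : V, ∑ G : Fin κ → V, w (φ (G + Pi.single j₀ ((b' j₀ - b j₀)⁻¹ • v))) := by
            simp only [htrans, Finset.sum_const, Finset.card_univ, nsmul_eq_mul]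
        _ = ∑ G : Fin κ → V, ∑ v, w (φ G + v) := by
            simp only [hsec]
            exact Finset.sum_comm
        _ = ∑ G : Fin κ → V, ∑ v, w v :=
            Finset.sum_congr rfl fun G _ => Equiv.sum_comp (Equiv.addLeft (φ G)) w
        _ = _ := by simp only [Finset.sum_const, Finset.card_univ, nsmul_eq_mul]
    simp only [linearWord, Fintype.sum_prod_type, hshift]
    rw [Finset.sum_comm]
    simp only [← Finset.mul_sum]
    calc (Fintype.card V : ℝ) ^ 2 * ∑ v, f v * ∑ G, g (v + φ G)
        = Fintype.card V * ∑ v, f v * (Fintype.card V * ∑ G, g (v + φ G)) := by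
          rw [pow_two, mul_assoc, Finset.mul_sum (a := (Fintype.card V : ℝ))]
          congr 1
          exact Finset.sum_congr rfl fun v _ => by ring
      _ = Fintype.card V * ∑ v, f v * (Fintype.card (Fin κ → V) * ∑ v, g v) := by
          congr 1
          refine Finset.sum_congr rfl fun v _ => ?_
          rw [hfib (fun u => g (v + u))]
          congr 2
          exact Equiv.sum_comp (Equiv.addLeft v) g
      _ = _ := by
          rw [← Finset.sum_mul, Fintype.card_prod, Nat.cast_mul]
          generalize (Fintype.card (Fin κ → V) : ℝ) = K
          ring

/-- The linear code spanned by the seed of `linearWord`. -/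
def linearCode (F : Type*) {V : Type*} [Field F] [AddCommGroup V] [Module F V] {κ : ℕ}
    (ω : (Fin κ → V) × V) : Submodule F V :=
  Submodule.span F (Set.range (Fin.cons ω.2 ω.1 : Fin (κ + 1) → V))

theorem linearWord_mem {F V : Type*} [Field F] [AddCommGroup V] [Module F V] {κ : ℕ}
    (ω : (Fin κ → V) × V) (b : Fin κ → F) :
    linearWord ω b ∈ linearCode F ω := by
  refine add_mem (Submodule.subset_span ⟨0, rfl⟩) (sum_mem fun j _ => Submodule.smul_mem _ _ ?_)
  exact Submodule.subset_span ⟨j.succ, by simp⟩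

/-- The `+ 1` pays for adjoining the shift, which turns the affine code into a linear one. -/
theorem card_linearCode_le [Fintype F] (ω : (Fin κ → V) × V) :
    Nat.card (linearCode F ω) ≤ Fintype.card F ^ (κ + 1) := by
  rw [← Nat.card_eq_fintype_card, Module.natCard_eq_pow_finrank (K := F)]
  refine Nat.pow_le_pow_right Nat.card_pos ?_
  have := finrank_range_le_card (R := F) (Fin.cons ω.2 ω.1 : Fin (κ + 1) → V)
  rwa [Fintype.card_fin] at this

end LinearCode

/-! ### Choosing one good codebook -/

section OneShot

/-- The weight with which the word `v` enters `codeSum c ω`. -/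
noncomputable def codeWeight {V Ω B : Type*} [Fintype V] [DecidableEq V] [Fintype B]
    (c : Ω → B → V) (ω : Ω) (v : V) : ℝ :=
  (Fintype.card V : ℝ) / Fintype.card B * (Finset.univ.filter fun b => c ω b = v).card

theorem codeSum_eq_sum_codeWeight {V Ω B : Type*} [Fintype V] [DecidableEq V] [Fintype B]
    (c : Ω → B → V) (ω : Ω) (f : V → ℝ) :
    codeSum c ω f = ∑ v, codeWeight c ω v * f v := by
  simp only [codeSum, codeWeight, mul_assoc]
  rw [← Finset.mul_sum, ← Finset.sum_fiberwise Finset.univ (c ω) (fun b => f (c ω b))]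
  congr 1
  refine Finset.sum_congr rfl fun v _ => ?_
  rw [Finset.sum_congr rfl (g := fun _ => f v)]
  · simp
  · intro b hb
    rw [(Finset.mem_filter.mp hb).2]

theorem codeWeight_nonneg {V Ω B : Type*} [Fintype V] [DecidableEq V] [Fintype B]
    (c : Ω → B → V) (ω : Ω) (v : V) : 0 ≤ codeWeight c ω v := by
  unfold codeWeight
  positivity

theorem exists_of_codeWeight_ne_zero {V Ω B : Type*} [Fintype V] [DecidableEq V] [Fintype B]
    {c : Ω → B → V} {ω : Ω} {v : V} (h : codeWeight c ω v ≠ 0) : ∃ b, c ω b = v := by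
  by_contra! hb
  exact h (by simp [codeWeight, hb])

/-- Some codebook of a pairwise uniform family covers every context well on average, without
increasing the total of a given cost `g`. -/
theorem IsPairwiseUniform.exists_codeSum_le {V Ω B Z : Type*} [Fintype V] [Fintype Ω] [Fintype B]
    [Fintype Z] [Nonempty V] [Nonempty B] [Nonempty Ω] {c : Ω → B → V} (hc : IsPairwiseUniform c)
    {f r : Z → V → ℝ} (hf : ∀ z v, 0 ≤ f z v) (hr : ∀ z v, 0 ≤ r z v) {m : Z → ℝ} {K ρ : ℝ}
    (hK : 0 ≤ K) (hfK : ∀ z v, f z v ≤ K * m z) (hm : ∀ z, ∑ v, (f z v + r z v) = m z)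
    (hm1 : ∑ z, m z = 1) (hρ : ∑ z, ∑ v, r z v ≤ ρ) (g : Z → V → ℝ) :
    ∃ ω, ∑ z, codeSum c ω (g z) + ∑ z, |codeSum c ω (fun v => f z v + r z v) - m z| ≤
      ∑ z, ∑ v, g z v + (√((Fintype.card V : ℝ) / Fintype.card B * K) + 2 * ρ) := by
  set s := √((Fintype.card V : ℝ) / Fintype.card B * K)
  have key : ∀ z, ∑ ω, |codeSum c ω (fun v => f z v + r z v) - m z| ≤
      Fintype.card Ω * (m z * s + 2 * ∑ v, r z v) := by
    intro z
    have := hc.sum_abs_codeSum_sub_le (hf z) (hr z) (hfK z) hK (by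
      rw [← hm z]
      exact Finset.sum_le_sum fun v _ => le_add_of_nonneg_right (hr z v))
    rwa [hm z] at this
  -- The cost is averaged exactly, by unbiasedness, so cost and deviation can be controlled by the
  -- same seed.
  obtain ⟨ω, -, hω⟩ := Finset.exists_le_of_sum_le (s := (Finset.univ : Finset Ω))
    Finset.univ_nonempty
    (f := fun ω => ∑ z, codeSum c ω (g z) + ∑ z, |codeSum c ω (fun v => f z v + r z v) - m z|)
    (g := fun _ => ∑ z, ∑ v, g z v + (s + 2 * ρ)) (by
      rw [Finset.sum_add_distrib, Finset.sum_comm, Finset.sum_comm (s := Finset.univ (α := Ω))]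
      simp only [hc.sum_codeSum, Finset.sum_const, Finset.card_univ, nsmul_eq_mul]
      rw [← Finset.mul_sum, mul_add]
      refine add_le_add le_rfl ((Finset.sum_le_sum fun z _ => key z).trans ?_)
      rw [← Finset.mul_sum, Finset.sum_add_distrib, ← Finset.sum_mul, hm1, ← Finset.mul_sum, one_mul]
      gcongr)
  exact ⟨ω, hω⟩

end OneShot

/-! ### Conditional entropy and typicality -/

section Entropy

/-- The conditional entropy in nats of the second component under the joint law `Q`, as the
difference of the joint entropy and the entropy of the first component. -/
noncomputable def entropyDiff {Z A : Type*} [Fintype Z] [Fintype A] (Q : Z → A → ℝ) : ℝ :=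
  ∑ z, ∑ a, Real.negMulLog (Q z a) - ∑ z, Real.negMulLog (∑ a, Q z a)

variable {Z A : Type*} [Fintype Z] [Fintype A] {Q : Z → A → ℝ}

theorem entropyDiff_eq (Q : Z → A → ℝ) :
    entropyDiff Q = ∑ z, ∑ a, Q z a * (Real.log (∑ a, Q z a) - Real.log (Q z a)) := by
  unfold entropyDiff
  rw [← Finset.sum_sub_distrib]
  refine Finset.sum_congr rfl fun z _ => ?_
  simp only [mul_sub, Finset.sum_sub_distrib, ← Finset.sum_mul, Real.negMulLog, neg_mul,
    Finset.sum_neg_distrib]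
  ring

theorem entropyDiff_le_log_card [Nonempty A] (hQ : ∀ z a, 0 ≤ Q z a)
    (hQ1 : ∑ z, ∑ a, Q z a = 1) : entropyDiff Q ≤ Real.log (Fintype.card A) := by
  have hA : (0 : ℝ) < Fintype.card A := by exact_mod_cast Fintype.card_pos
  -- Gibbs' inequality via `log x ≤ x - 1`; the correction terms sum to zero.
  have hterm : ∀ z a, Q z a * (Real.log (∑ a, Q z a) - Real.log (Q z a)) ≤
      Q z a * Real.log (Fintype.card A) + ((∑ a, Q z a) / Fintype.card A - Q z a) := by
    intro z a
    rcases (hQ z a).eq_or_lt with h | h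
    · rw [← h]
      have : 0 ≤ ∑ a, Q z a := Finset.sum_nonneg fun a _ => hQ z a
      simp only [zero_mul, sub_zero, zero_add]
      positivity
    · have hm : 0 < ∑ a, Q z a :=
        h.trans_le (Finset.single_le_sum (fun a _ => hQ z a) (Finset.mem_univ a))
      have := Real.log_le_sub_one_of_pos (div_pos hm (mul_pos hA h))
      rw [Real.log_div hm.ne' (mul_pos hA h).ne', Real.log_mul hA.ne' h.ne'] at this
      have h2 := mul_le_mul_of_nonneg_left this h.le
      have h3 : Q z a * ((∑ a, Q z a) / (Fintype.card A * Q z a) - 1) =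
          (∑ a, Q z a) / Fintype.card A - Q z a := by
        field_simp
      rw [h3] at h2
      linarith
  calc entropyDiff Q ≤ ∑ z, ∑ a, (Q z a * Real.log (Fintype.card A) +
        ((∑ a, Q z a) / Fintype.card A - Q z a)) := by
        rw [entropyDiff_eq]
        exact Finset.sum_le_sum fun z _ => Finset.sum_le_sum fun a _ => hterm z a
    _ = Real.log (Fintype.card A) := by
        simp only [Finset.sum_add_distrib, Finset.sum_sub_distrib, ← Finset.sum_mul, hQ1,
          Finset.sum_const, Finset.card_univ, nsmul_eq_mul, mul_div_cancel₀ _ hA.ne']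
        simp

theorem sum_pi_prod {A : Type*} [Fintype A] {n : ℕ} (q : Fin n → A → ℝ) :
    ∑ u : Fin n → A, ∏ t, q t (u t) = ∏ t, ∑ a, q t a := by
  rw [Finset.prod_univ_sum, Fintype.piFinset_univ]

theorem sum_pi_prodMk {Z A : Type*} [Fintype Z] [Fintype A] {n : ℕ}
    (f : (Fin n → Z × A) → ℝ) :
    ∑ z : Fin n → Z, ∑ u : Fin n → A, f (fun t => (z t, u t)) = ∑ i, f i := by
  rw [← Fintype.sum_prod_type']
  exact Equiv.sum_comp (Equiv.arrowProdEquivProdArrow (Fin n) (fun _ => Z) (fun _ => A)).symm f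

/-- The conditional asymptotic equipartition property, one-sided and with exponential rate. -/
theorem exists_rate_atypical (hQ : ∀ z a, 0 ≤ Q z a) (hQ1 : ∑ z, ∑ a, Q z a = 1) {δ : ℝ}
    (hδ : 0 < δ) :
    ∃ ρ : ℝ, 0 ≤ ρ ∧ ρ < 1 ∧ ∀ n : ℕ, ∑ z : Fin n → Z, ∑ u : Fin n → A,
      (if ∏ t, Q (z t) (u t) ≤ Real.exp (-(n * (entropyDiff Q - δ))) * ∏ t, ∑ a, Q (z t) a
        then 0 else ∏ t, Q (z t) (u t)) ≤ ρ ^ n := by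
  -- The function fed to the tail bound has mean `-δ`, and its sum is positive on atypical pairs.
  obtain ⟨ρ, h0, h1, h⟩ := exists_chernoff_rate (I := Z × A) (fun i => Q i.1 i.2)
    (fun i => hQ _ _) (by rw [Fintype.sum_prod_type]; exact hQ1)
    (fun i => (entropyDiff Q - δ) - (Real.log (∑ a, Q i.1 a) - Real.log (Q i.1 i.2))) (by
      rw [Fintype.sum_prod_type]
      simp only [mul_sub (Q _ _) (entropyDiff Q - δ), Finset.sum_sub_distrib, ← Finset.sum_mul,
        hQ1]
      rw [← entropyDiff_eq]
      linarith)
  refine ⟨ρ, h0, h1, fun n => ?_⟩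
  set P : (Fin n → Z × A) → Prop := fun i => ∏ t, Q (i t).1 (i t).2 ≤
    Real.exp (-(n * (entropyDiff Q - δ))) * ∏ t, ∑ a, Q (i t).1 a with hP
  classical
  refine le_trans (le_of_eq ?_) (h n (Finset.univ.filter fun i => ¬ P i) ?_)
  · rw [Finset.sum_filter, ← sum_pi_prodMk]
    simp only [hP, ite_not]
  · intro i hi
    have hi : ¬ P i := (Finset.mem_filter.mp hi).2
    simp only [hP, not_le] at hi
    have hm0 : ∀ t, 0 ≤ ∑ a, Q (i t).1 a := fun t => Finset.sum_nonneg fun a _ => hQ _ _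
    have hpos : ∏ t, Q (i t).1 (i t).2 ≠ 0 := by
      refine (lt_of_le_of_lt ?_ hi).ne'
      exact mul_nonneg (Real.exp_pos _).le (Finset.prod_nonneg fun t _ => hm0 t)
    have hQt : ∀ t, Q (i t).1 (i t).2 ≠ 0 := fun t =>
      Finset.prod_ne_zero_iff.mp hpos t (Finset.mem_univ t)
    have hmt : ∀ t, ∑ a, Q (i t).1 a ≠ 0 := fun t => by
      refine (lt_of_lt_of_le ((hQ _ _).lt_of_ne' (hQt t))
        (Finset.single_le_sum (f := fun a => Q (i t).1 a) (fun a _ => hQ _ _)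
          (Finset.mem_univ (i t).2))).ne'
    have hmpos : 0 < ∏ t, ∑ a, Q (i t).1 a :=
      Finset.prod_pos fun t _ => (hm0 t).lt_of_ne' (hmt t)
    have hlog := Real.log_lt_log (mul_pos (Real.exp_pos _) hmpos) hi
    rw [Real.log_mul (Real.exp_pos _).ne' hmpos.ne', Real.log_exp,
      Real.log_prod (fun t _ => hmt t), Real.log_prod (fun t _ => hQt t)] at hlog
    simp only [Finset.sum_sub_distrib, Finset.sum_const, Finset.card_univ, Fintype.card_fin,
      nsmul_eq_mul]
    linarith

end Entropy

/-! ### Covering with one linear code -/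

section SingleDigit

/-- The word weights `τ` of a code of length `n` cover the memoryless extension of the joint law
`Q` up to `η`, without increasing the total of the cost `g` by more than `η`. -/
def Covers {Z A : Type*} [Fintype Z] [Fintype A] (Q : Z → A → ℝ) {n : ℕ}
    (τ : (Fin n → A) → ℝ) (g : (Fin n → Z) → (Fin n → A) → ℝ) (η : ℝ) : Prop :=
  ∑ z, ∑ u, τ u * g z u +
      ∑ z : Fin n → Z, |∑ u, τ u * ∏ t, Q (z t) (u t) - ∏ t, ∑ a, Q (z t) a| ≤
    ∑ z, ∑ u, g z u + η

/-- The threshold `N` precedes the cost `g`: the induction over digits uses a cost built from a code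
that itself depends on `n`. -/
theorem exists_linear_covering {Z : Type*} [Fintype Z] {p : ℕ} [Fact p.Prime]
    {Q : Z → ZMod p → ℝ} (hQ : ∀ z a, 0 ≤ Q z a) (hQ1 : ∑ z, ∑ a, Q z a = 1) {δ η : ℝ}
    (hδ : 0 < δ) (hη : 0 < η) :
    ∃ N : ℕ, ∀ n, N ≤ n → ∀ g : (Fin n → Z) → (Fin n → ZMod p) → ℝ,
      ∃ (C : Submodule (ZMod p) (Fin n → ZMod p)) (τ : (Fin n → ZMod p) → ℝ),
        (∀ v, 0 ≤ τ v) ∧ (∀ v, τ v ≠ 0 → v ∈ C) ∧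
        Real.log (Nat.card C) ≤ n * (Real.log p - entropyDiff Q + δ) ∧ Covers Q τ g η := by
  set h := entropyDiff Q with hh
  set L := Real.log p with hL
  have hp1 : (1 : ℝ) < p := by exact_mod_cast (Fact.out : p.Prime).one_lt
  have hLpos : 0 < L := Real.log_pos hp1
  have hhL : h ≤ L := by
    have := entropyDiff_le_log_card hQ hQ1
    rwa [ZMod.card] at this
  obtain ⟨ρ, hρ0, hρ1, hρ⟩ := exists_rate_atypical hQ hQ1 (by positivity : 0 < δ / 4)
  have hlim : Filter.Tendsto (fun n : ℕ => Real.exp (-(δ / 8)) ^ n + 2 * ρ ^ n)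
      Filter.atTop (nhds 0) := by
    have h1 := tendsto_pow_atTop_nhds_zero_of_lt_one (Real.exp_pos (-(δ / 8))).le
      (Real.exp_lt_one_iff.mpr (by linarith))
    have h2 := tendsto_pow_atTop_nhds_zero_of_lt_one hρ0 hρ1
    simpa using h1.add (h2.const_mul 2)
  obtain ⟨N₁, hN₁⟩ := Filter.eventually_atTop.mp (hlim.eventually (gt_mem_nhds hη))
  -- Beyond `4L/δ` the spare rate `nδ/2` absorbs `2L`: one `L` from rounding `κ` up, one from the
  -- shift.
  refine ⟨max N₁ ⌈4 * L / δ⌉₊, fun n hn g => ?_⟩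
  have hn1 := hN₁ n ((le_max_left _ _).trans hn)
  have hn2 : 4 * L ≤ n * δ := by
    have : 4 * L / δ ≤ n := (Nat.le_ceil _).trans (by exact_mod_cast (le_max_right _ _).trans hn)
    rwa [div_le_iff₀ hδ] at this
  set κ := ⌈n * (L - h + δ / 2) / L⌉₊ with hκ
  have hnn : (0 : ℝ) ≤ n := Nat.cast_nonneg n
  have hκ1 : n * (L - h + δ / 2) ≤ κ * L := by
    have := Nat.le_ceil (n * (L - h + δ / 2) / L)
    rwa [div_le_iff₀ hLpos] at this
  have hκ2 : κ * L ≤ n * (L - h + δ / 2) + L := by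
    have hx : 0 ≤ n * (L - h + δ / 2) / L :=
      div_nonneg (mul_nonneg hnn (by linarith)) hLpos.le
    have := (Nat.ceil_lt_add_one hx).le
    calc (κ : ℝ) * L ≤ (n * (L - h + δ / 2) / L + 1) * L :=
          mul_le_mul_of_nonneg_right this hLpos.le
      _ = _ := by field_simp
  set K := Real.exp (-(n * (h - δ / 4))) with hK
  set good : (Fin n → Z) → (Fin n → ZMod p) → Prop := fun z u =>
    ∏ t, Q (z t) (u t) ≤ K * ∏ t, ∑ a, Q (z t) a with hgood
  classical
  have hpr : ∀ (z : Fin n → Z) (u : Fin n → ZMod p), 0 ≤ ∏ t, Q (z t) (u t) :=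
    fun z u => Finset.prod_nonneg fun t _ => hQ _ _
  have hsplit : ∀ z u, (if good z u then ∏ t, Q (z t) (u t) else 0) +
      (if good z u then 0 else ∏ t, Q (z t) (u t)) = ∏ t, Q (z t) (u t) := by
    intro z u
    split_ifs <;> simp
  obtain ⟨ω, hω⟩ := (isPairwiseUniform_linearWord (F := ZMod p) (V := Fin n → ZMod p)
      (κ := κ)).exists_codeSum_le
    (f := fun z u => if good z u then ∏ t, Q (z t) (u t) else 0)
    (r := fun z u => if good z u then 0 else ∏ t, Q (z t) (u t))
    (m := fun z => ∏ t, ∑ a, Q (z t) a) (K := K) (ρ := ρ ^ n)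
    (fun z u => by split_ifs; exacts [hpr z u, le_rfl])
    (fun z u => by split_ifs; exacts [le_rfl, hpr z u])
    (Real.exp_pos _).le
    (fun z u => by
      split_ifs with hg
      · exact hg
      · exact mul_nonneg (Real.exp_pos _).le
          (Finset.prod_nonneg fun t _ => Finset.sum_nonneg fun a _ => hQ _ _))
    (fun z => by
      simp only [hsplit]
      exact sum_pi_prod fun t a => Q (z t) a)
    (by rw [sum_pi_prod fun _ z => ∑ a, Q z a, hQ1]; simp)
    (by convert hρ n) g
  refine ⟨linearCode (ZMod p) ω, codeWeight (linearWord (F := ZMod p)) ω,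
    codeWeight_nonneg _ _, ?_, ?_, ?_⟩
  · intro v hv
    obtain ⟨b, rfl⟩ := exists_of_codeWeight_ne_zero hv
    exact linearWord_mem ω b
  · have hcard := card_linearCode_le (F := ZMod p) ω
    rw [ZMod.card] at hcard
    calc Real.log (Nat.card (linearCode (ZMod p) ω))
        ≤ Real.log ((p : ℝ) ^ (κ + 1)) :=
          Real.log_le_log (by exact_mod_cast Nat.card_pos) (by exact_mod_cast hcard)
      _ = κ * L + L := by
          rw [Real.log_pow]
          push_cast
          ring
      _ ≤ _ := by nlinarith
  · simp only [hsplit, codeSum_eq_sum_codeWeight] at hω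
    refine hω.trans (add_le_add le_rfl (le_trans (add_le_add ?_ le_rfl) hn1.le))
    have hp0 : (0 : ℝ) < p := by linarith
    have hpexp : ∀ j : ℕ, (p : ℝ) ^ j = Real.exp (j * L) := by
      intro j
      rw [Real.exp_nat_mul, hL, Real.exp_log hp0]
    rw [← Real.exp_nat_mul]
    refine Real.sqrt_le_iff.mpr ⟨(Real.exp_pos _).le, ?_⟩
    simp only [Fintype.card_fun, ZMod.card, Fintype.card_fin, Nat.cast_pow, hpexp]
    -- Rate excess `δ/2` minus typicality slack `δ/4` leaves `-nδ/4` under the root, hence the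
    -- `δ/8`.
    rw [hK, ← Real.exp_sub, ← Real.exp_add, ← Real.exp_nat_mul]
    refine Real.exp_le_exp.mpr ?_
    push_cast
    linarith

end SingleDigit

/-! ### Peeling off one digit -/

section SplitFirstDigit

theorem sum_fin_cons {k : ℕ} {α : Fin (k + 1) → Type*} [∀ i, Fintype (α i)]
    (f : (∀ i, α i) → ℝ) :
    ∑ a, f a = ∑ a₀ : α 0, ∑ r : ∀ i : Fin k, α i.succ, f (Fin.cons a₀ r) := by
  rw [← Fintype.sum_prod_type']
  exact (Equiv.sum_comp (Fin.consEquiv α) f).symm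

theorem sum_word_cons {k n : ℕ} {α : Fin (k + 1) → Type*} [∀ i, Fintype (α i)]
    (f : (Fin n → ∀ i, α i) → ℝ) :
    ∑ u, f u = ∑ a : Fin n → α 0, ∑ r : Fin n → ∀ i : Fin k, α i.succ,
      f (fun t => Fin.cons (a t) (r t)) := by
  rw [sum_pi_prodMk (fun i : Fin n → α 0 × ∀ i : Fin k, α i.succ =>
    f (fun t => Fin.cons (i t).1 (i t).2))]
  exact (Equiv.sum_comp (Equiv.arrowCongr (Equiv.refl (Fin n)) (Fin.consEquiv α)) f).symm

/-- The chain rule: the entropy of context and first digit jointly telescopes. -/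
theorem entropyDiff_cons {k : ℕ} {α : Fin (k + 1) → Type*} [∀ i, Fintype (α i)] {Z : Type*}
    [Fintype Z] (Q : Z → (∀ i, α i) → ℝ) :
    entropyDiff Q =
      entropyDiff (fun (y : Z × α 0) (r : ∀ i : Fin k, α i.succ) => Q y.1 (Fin.cons y.2 r)) +
      entropyDiff (fun z a₀ => ∑ r : ∀ i : Fin k, α i.succ, Q z (Fin.cons a₀ r)) := by
  simp only [entropyDiff, Fintype.sum_prod_type, sum_fin_cons]
  ring

theorem mem_codebook_cons {k n : ℕ} {p : Fin (k + 1) → ℕ}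
    (C₀ : Submodule (ZMod (p 0)) (Fin n → ZMod (p 0)))
    (C : ∀ i : Fin k, Submodule (ZMod (p i.succ)) (Fin n → ZMod (p i.succ)))
    (u : Fin n → ∀ i, ZMod (p i)) :
    u ∈ codebook (Fin.cons C₀ C : ∀ i, Submodule (ZMod (p i)) (Fin n → ZMod (p i))) ↔
      (fun t => u t 0) ∈ C₀ ∧ (fun t => Fin.tail (u t)) ∈ codebook C :=
  Fin.forall_fin_succ

theorem card_codebook_cons_le {k n : ℕ} {p : Fin (k + 1) → ℕ} [∀ i, NeZero (p i)]
    (C₀ : Submodule (ZMod (p 0)) (Fin n → ZMod (p 0)))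
    (C : ∀ i : Fin k, Submodule (ZMod (p i.succ)) (Fin n → ZMod (p i.succ))) :
    Nat.card (codebook (Fin.cons C₀ C :
        ∀ i, Submodule (ZMod (p i)) (Fin n → ZMod (p i)))) ≤
      Nat.card C₀ * Nat.card (codebook C) := by
  rw [← Nat.card_prod]
  refine Nat.card_le_card_of_injective
    (fun u => (⟨fun t => u.1 t 0, ((mem_codebook_cons C₀ C u.1).mp u.2).1⟩,
      ⟨fun t => Fin.tail (u.1 t), ((mem_codebook_cons C₀ C u.1).mp u.2).2⟩)) ?_
  intro u v huv
  simp only [Prod.mk.injEq, Subtype.mk.injEq] at huv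
  refine Subtype.ext (funext fun t => ?_)
  rw [← Fin.cons_self_tail (u.1 t), ← Fin.cons_self_tail (v.1 t), congrFun huv.1 t,
    congrFun huv.2 t]

/-- Coverings of the first digit and of the remaining digits given the first one combine. -/
theorem Covers.cons {k n : ℕ} {α : Fin (k + 1) → Type*} [∀ i, Fintype (α i)] {Z : Type*}
    [Fintype Z] {Q : Z → (∀ i, α i) → ℝ} {τ₀ : (Fin n → α 0) → ℝ} (hτ₀ : ∀ a, 0 ≤ τ₀ a)
    {τ : (Fin n → ∀ i : Fin k, α i.succ) → ℝ} {g : (Fin n → Z) → (Fin n → ∀ i, α i) → ℝ}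
    {η η₀ : ℝ}
    (h : Covers (fun (y : Z × α 0) (r : ∀ i : Fin k, α i.succ) => Q y.1 (Fin.cons y.2 r)) τ
      (fun y r => g (fun t => (y t).1) (fun t => Fin.cons (y t).2 (r t))) η)
    (h₀ : Covers (fun z a₀ => ∑ r : ∀ i : Fin k, α i.succ, Q z (Fin.cons a₀ r)) τ₀
      (fun z a => ∑ r, τ r * g z (fun t => Fin.cons (a t) (r t)) +
        |∑ r, τ r * ∏ t, Q (z t) (Fin.cons (a t) (r t)) -
          ∏ t, ∑ r : ∀ i : Fin k, α i.succ, Q (z t) (Fin.cons (a t) r)|) η₀) :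
    Covers Q (fun u => τ₀ (fun t => u t 0) * τ (fun t => Fin.tail (u t))) g (η + η₀) := by
  unfold Covers at *
  simp only [← sum_pi_prodMk] at h
  simp only [mul_add, Finset.sum_add_distrib] at h₀
  simp only [sum_word_cons, sum_fin_cons, Fin.cons_zero, Fin.tail_cons]
  have h1 : ∀ (a : Fin n → α 0) (G : (Fin n → ∀ i : Fin k, α i.succ) → ℝ),
      ∑ r, τ₀ a * τ r * G r = τ₀ a * ∑ r, τ r * G r := by
    intro a G
    simp only [mul_assoc, ← Finset.mul_sum]
  have h2 : ∀ z : Fin n → Z,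
      |∑ a, ∑ r, τ₀ a * τ r * ∏ t, Q (z t) (Fin.cons (a t) (r t)) -
        ∏ t, ∑ a₀, ∑ r : ∀ i : Fin k, α i.succ, Q (z t) (Fin.cons a₀ r)| ≤
      ∑ a, τ₀ a * |∑ r, τ r * ∏ t, Q (z t) (Fin.cons (a t) (r t)) -
          ∏ t, ∑ r : ∀ i : Fin k, α i.succ, Q (z t) (Fin.cons (a t) r)| +
      |∑ a, τ₀ a * ∏ t, ∑ r : ∀ i : Fin k, α i.succ, Q (z t) (Fin.cons (a t) r) -
        ∏ t, ∑ a₀, ∑ r : ∀ i : Fin k, α i.succ, Q (z t) (Fin.cons a₀ r)| := by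
    intro z
    refine le_trans (abs_sub_le _ (∑ a, τ₀ a *
      ∏ t, ∑ r : ∀ i : Fin k, α i.succ, Q (z t) (Fin.cons (a t) r)) _) (add_le_add ?_ le_rfl)
    rw [← Finset.sum_sub_distrib]
    refine (Finset.abs_sum_le_sum_abs _ _).trans (Finset.sum_le_sum fun a _ => ?_)
    rw [h1, ← mul_sub, abs_mul, abs_of_nonneg (hτ₀ a)]
  have h3 := Finset.sum_le_sum fun z (_ : z ∈ (Finset.univ : Finset (Fin n → Z))) => h2 z
  rw [Finset.sum_add_distrib] at h3
  simp only [h1] at h3 ⊢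
  linarith

end SplitFirstDigit

/-- Group codes over `⊕ ℤ/p_i` cover any joint law at every rate above `∑ log p_i - H(A|Z)`. -/
theorem exists_group_covering {k : ℕ} (p : Fin k → ℕ) [∀ i, Fact (p i).Prime] {Z : Type*}
    [Fintype Z] {Q : Z → (∀ i, ZMod (p i)) → ℝ} (hQ : ∀ z a, 0 ≤ Q z a)
    (hQ1 : ∑ z, ∑ a, Q z a = 1) {δ η : ℝ} (hδ : 0 < δ) (hη : 0 < η) :
    ∃ N : ℕ, ∀ n, N ≤ n → ∀ g : (Fin n → Z) → (Fin n → ∀ i, ZMod (p i)) → ℝ,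
      ∃ (C : ∀ i, Submodule (ZMod (p i)) (Fin n → ZMod (p i)))
        (τ : (Fin n → ∀ i, ZMod (p i)) → ℝ),
        (∀ u, 0 ≤ τ u) ∧ (∀ u, τ u ≠ 0 → u ∈ codebook C) ∧
        Real.log (Nat.card (codebook C)) ≤
          n * (∑ i, Real.log (p i) - entropyDiff Q + δ) ∧ Covers Q τ g η := by
  induction k generalizing Z δ η with
  | zero =>
    refine ⟨0, fun n _ g => ⟨fun i => i.elim0, fun _ => 1, fun _ => zero_le_one,
      fun _ _ i => i.elim0, ?_, ?_⟩⟩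
    · have : Nat.card (codebook (n := n) (p := p) fun i => i.elim0) ≤ 1 :=
        Finite.card_le_one_iff_subsingleton.mpr inferInstance
      have hlog : Real.log (Nat.card (codebook (n := n) (p := p) fun i => i.elim0)) ≤ 0 :=
        Real.log_nonpos (Nat.cast_nonneg _) (by exact_mod_cast this)
      have hent : entropyDiff Q = 0 := by simp [entropyDiff]
      rw [hent]
      simp only [Finset.univ_eq_empty, Finset.sum_empty]
      have : 0 ≤ n * (0 - 0 + δ) := mul_nonneg (Nat.cast_nonneg n) (by linarith)
      linarith
    · simp only [Covers, Finset.univ_unique, Finset.sum_singleton, one_mul]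
      refine add_le_add le_rfl (le_of_eq_of_le (Finset.sum_eq_zero fun z _ => ?_) hη.le)
      rw [abs_eq_zero, sub_eq_zero]
      exact Finset.prod_congr rfl fun t _ => congrArg _ (Subsingleton.elim _ _)
  | succ k ih =>
    have hQ' : ∀ (y : Z × ZMod (p 0)) (r : ∀ i : Fin k, ZMod (p i.succ)),
        0 ≤ Q y.1 (Fin.cons y.2 r) := fun y r => hQ _ _
    obtain ⟨N, hN⟩ := ih (fun i => p i.succ)
      (Q := fun (y : Z × ZMod (p 0)) (r : ∀ i : Fin k, ZMod (p i.succ)) => Q y.1 (Fin.cons y.2 r))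
      hQ' (by
        rw [Fintype.sum_prod_type, ← hQ1]
        simp only [sum_fin_cons])
      (half_pos hδ) (half_pos hη)
    obtain ⟨N₀, hN₀⟩ := exists_linear_covering
      (Q := fun z a₀ => ∑ r : ∀ i : Fin k, ZMod (p i.succ), Q z (Fin.cons a₀ r))
      (fun z a => Finset.sum_nonneg fun r _ => hQ _ _) (by
        rw [← hQ1]
        simp only [sum_fin_cons])
      (half_pos hδ) (half_pos hη)
    refine ⟨max N N₀, fun n hn g => ?_⟩
    obtain ⟨C, τ, hτ, hτC, hC, hcov⟩ := hN n ((le_max_left _ _).trans hn)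
      (fun y r => g (fun t => (y t).1) (fun t => Fin.cons (y t).2 (r t)))
    -- The code for the later digits is already fixed; its cost and covering error at each
    -- first-digit word form the cost here.
    obtain ⟨C₀, τ₀, hτ₀, hτC₀, hC₀, hcov₀⟩ := hN₀ n ((le_max_right _ _).trans hn)
      (fun z a => ∑ r, τ r * g z (fun t => Fin.cons (a t) (r t)) +
        |∑ r, τ r * ∏ t, Q (z t) (Fin.cons (a t) (r t)) -
          ∏ t, ∑ r : ∀ i : Fin k, ZMod (p i.succ), Q (z t) (Fin.cons (a t) r)|)
    refine ⟨Fin.cons C₀ C, fun u => τ₀ (fun t => u t 0) * τ (fun t => Fin.tail (u t)),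
      fun u => mul_nonneg (hτ₀ _) (hτ _), fun u hu => ?_, ?_, ?_⟩
    · exact (mem_codebook_cons C₀ C u).mpr
        ⟨hτC₀ _ (left_ne_zero_of_mul hu), hτC _ (right_ne_zero_of_mul hu)⟩
    · have h0 : (Nat.card C₀ : ℝ) ≠ 0 := Nat.cast_ne_zero.mpr Nat.card_pos.ne'
      have h1 : (Nat.card (codebook C) : ℝ) ≠ 0 := Nat.cast_ne_zero.mpr Nat.card_pos.ne'
      have hcard : (Nat.card (codebook (Fin.cons C₀ C :
          ∀ i, Submodule (ZMod (p i)) (Fin n → ZMod (p i)))) : ℝ) ≤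
          (Nat.card C₀ : ℝ) * (Nat.card (codebook C) : ℝ) := by
        rw [← Nat.cast_mul]
        exact Nat.cast_le.mpr (card_codebook_cons_le C₀ C)
      refine (Real.log_le_log (Nat.cast_pos.mpr Nat.card_pos) hcard).trans ?_
      rw [Real.log_mul h0 h1, Fin.sum_univ_succ, entropyDiff_cons]
      linarith
    · have := Covers.cons (α := fun i => ZMod (p i)) (Q := Q) (g := g) (τ := τ) hτ₀ hcov hcov₀
      rwa [add_halves] at this

/-! ### Transporting the test channel to the group -/

section Alphabets

/-- The joint law of the source and the embedded output of the test channel `W`. -/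
noncomputable def embeddedJoint {X U A : Type*} (S : U ↪ A) (P : X → ℝ) (W : X → U → ℝ)
    (x : X) (a : A) : ℝ :=
  Function.extend S (fun u => P x * W x u) 0 a

variable {X U A : Type*} {S : U ↪ A} {P : X → ℝ} {W : X → U → ℝ}

@[simp]
theorem embeddedJoint_apply (x : X) (u : U) : embeddedJoint S P W x (S u) = P x * W x u :=
  S.injective.extend_apply _ _ u

theorem embeddedJoint_eq_zero {x : X} {a : A} (h : a ∉ Set.range S) :
    embeddedJoint S P W x a = 0 :=
  Function.extend_apply' _ _ _ h

theorem embeddedJoint_nonneg (hP : ∀ x, 0 ≤ P x) (hW : ∀ x u, 0 ≤ W x u) (x : X) (a : A) :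
    0 ≤ embeddedJoint S P W x a := by
  by_cases h : a ∈ Set.range S
  · obtain ⟨u, rfl⟩ := h
    rw [embeddedJoint_apply]
    exact mul_nonneg (hP x) (hW x u)
  · rw [embeddedJoint_eq_zero h]

/-- `F` also sees the letter, so that mass, entropy and distortion are all covered. -/
theorem sum_embeddedJoint_comp [Fintype U] [Fintype A] (x : X) (F : A → ℝ → ℝ)
    (hF : ∀ a, F a 0 = 0) :
    ∑ a, F a (embeddedJoint S P W x a) = ∑ u, F (S u) (P x * W x u) := by
  refine (Fintype.sum_of_injective S S.injective _ _ (fun a ha => ?_) fun u => ?_).symm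
  · rw [embeddedJoint_eq_zero ha, hF]
  · rw [embeddedJoint_apply]

theorem sum_embeddedJoint [Fintype U] [Fintype A] (hW : ∀ x, ∑ u, W x u = 1) (x : X) :
    ∑ a, embeddedJoint S P W x a = P x := by
  rw [sum_embeddedJoint_comp x (fun _ y => y) fun _ => rfl, ← Finset.mul_sum, hW, mul_one]

theorem entropyDiff_embeddedJoint [Fintype X] [Fintype U] [Fintype A]
    (hW : ∀ x, ∑ u, W x u = 1) :
    entropyDiff (embeddedJoint S P W) = condEntropy P W * Real.log 2 := by
  have hlog : Real.log 2 ≠ 0 := (Real.log_pos one_lt_two).ne'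
  unfold entropyDiff condEntropy
  rw [← Finset.sum_sub_distrib, Finset.sum_mul]
  refine Finset.sum_congr rfl fun x _ => ?_
  rw [sum_embeddedJoint hW,
    sum_embeddedJoint_comp x (fun _ y => Real.negMulLog y) fun _ => Real.negMulLog_zero]
  simp only [Real.negMulLog_mul, Finset.sum_add_distrib, ← Finset.sum_mul, ← Finset.mul_sum, hW,
    ← Finset.sum_div]
  field_simp
  ring

end Alphabets

/-- The mean of an additive function under a product law. -/
theorem sum_prod_mul_sum {I : Type*} [Fintype I] {q : I → ℝ} (hq : ∑ i, q i = 1) (f : I → ℝ)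
    (n : ℕ) :
    ∑ i : Fin n → I, (∏ t, q (i t)) * ∑ t, f (i t) = n * ∑ i, q i * f i := by
  classical
  have h : ∀ s : Fin n, ∑ i : Fin n → I, (∏ t, q (i t)) * f (i s) = ∑ i, q i * f i := by
    intro s
    have h1 : ∀ i : Fin n → I, (∏ t, q (i t)) * f (i s) =
        ∏ t, (q (i t) * if t = s then f (i t) else 1) := by
      intro i
      rw [Finset.prod_mul_distrib, Finset.prod_ite_eq' Finset.univ s (fun t => f (i t)),
        if_pos (Finset.mem_univ s)]
    simp only [h1]
    rw [sum_pi_prod (fun t a => q a * if t = s then f a else 1), Finset.prod_eq_single s]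
    · simp
    · intro t _ ht
      simp [ht, hq]
    · simp
  simp only [Finset.mul_sum]
  rw [Finset.sum_comm]
  simp only [h, Finset.sum_const, Finset.card_univ, Fintype.card_fin, nsmul_eq_mul,
    Finset.mul_sum]

/-! ### From coverings to coding schemes -/

section Achievability

section WordDistortion

variable {X U : Type*}

/-- The normalized additive distortion between two words. -/
noncomputable def wordDistortion (d : X → U → ℝ) {n : ℕ} (x : Fin n → X) (u : Fin n → U) : ℝ :=
  (∑ t, d (x t) (u t)) / n

theorem wordDistortion_nonneg {d : X → U → ℝ} (hd : ∀ x u, 0 ≤ d x u) {n : ℕ} (x : Fin n → X)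
    (u : Fin n → U) : 0 ≤ wordDistortion d x u :=
  div_nonneg (Finset.sum_nonneg fun _ _ => hd _ _) (Nat.cast_nonneg n)

theorem wordDistortion_le {d : X → U → ℝ} {M : ℝ} (hM : 0 ≤ M) (hd : ∀ x u, d x u ≤ M) {n : ℕ}
    (x : Fin n → X) (u : Fin n → U) : wordDistortion d x u ≤ M := by
  refine div_le_of_le_mul₀ (Nat.cast_nonneg n) hM ?_
  calc ∑ t, d (x t) (u t) ≤ ∑ _t : Fin n, M := Finset.sum_le_sum fun t _ => hd _ _
    _ = M * n := by
        simp [mul_comm]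

end WordDistortion

variable {X U : Type*} [Fintype X] [Fintype U]

/-- A covering group code yields a scheme whose encoder minimizes the distortion. -/
theorem exists_groupScheme {k n : ℕ} {p : Fin k → ℕ} [∀ i, NeZero (p i)] [Nonempty U]
    (S : U ↪ (∀ i, ZMod (p i))) {P : X → ℝ} (hP : P ∈ stdSimplex ℝ X) {d : X → U → ℝ}
    (hd : ∀ x u, 0 ≤ d x u) {W : X → U → ℝ} (hW : ∀ x, W x ∈ stdSimplex ℝ U) {D lam η : ℝ}
    (hD : expDistortion P d W ≤ D) (hlam : 0 < lam) (hdlam : ∀ x u, d x u ≤ lam)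
    (hη : D / lam + η < 1) {C : ∀ i, Submodule (ZMod (p i)) (Fin n → ZMod (p i))}
    {τ : (Fin n → ∀ i, ZMod (p i)) → ℝ} (hτ : ∀ u, 0 ≤ τ u)
    (hτC : ∀ u, τ u ≠ 0 → u ∈ codebook C)
    (hcov : Covers (embeddedJoint S P W) τ (fun x u =>
      (∏ t, embeddedJoint S P W (x t) (u t)) *
        wordDistortion d x (fun t => Function.invFun S (u t)) / lam) η) :
    ∃ c : GroupScheme X S n, c.digitCode = C ∧ c.distortion P d ≤ D + lam * η := by
  set Q := embeddedJoint S P W with hQdef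
  have hQ : ∀ x a, 0 ≤ Q x a := embeddedJoint_nonneg hP.1 fun x => (hW x).1
  have hQm : ∀ x, ∑ a, Q x a = P x := sum_embeddedJoint fun x => (hW x).2
  set dist : (Fin n → X) → (Fin n → ∀ i, ZMod (p i)) → ℝ := fun x u =>
    wordDistortion d x (fun t => Function.invFun S (u t)) with hdist
  have hdist0 : ∀ x u, 0 ≤ dist x u := fun x u => wordDistortion_nonneg hd _ _
  have hpr : ∀ (x : Fin n → X) (u : Fin n → ∀ i, ZMod (p i)), 0 ≤ ∏ t, Q (x t) (u t) :=
    fun x u => Finset.prod_nonneg fun t _ => hQ _ _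
  have hmean : ∑ x : Fin n → X, ∑ u, (∏ t, Q (x t) (u t)) * dist x u / lam ≤ D / lam := by
    have h1 : ∑ x : Fin n → X, ∑ u : Fin n → ∀ i, ZMod (p i),
        (∏ t, Q (x t) (u t)) * ∑ t, d (x t) (Function.invFun S (u t)) =
        n * expDistortion P d W := by
      rw [sum_pi_prodMk (fun i : Fin n → X × ∀ i, ZMod (p i) =>
        (∏ t, Q (i t).1 (i t).2) * ∑ t, d (i t).1 (Function.invFun S (i t).2)),
        sum_prod_mul_sum (q := fun y : X × ∀ i, ZMod (p i) => Q y.1 y.2)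
          (by rw [Fintype.sum_prod_type]; simp only [hQm]; exact hP.2)
          (fun y => d y.1 (Function.invFun S y.2)), Fintype.sum_prod_type]
      congr 1
      refine Finset.sum_congr rfl fun x _ => ?_
      rw [sum_embeddedJoint_comp x (fun a y => y * d x (Function.invFun S a))
        fun _ => zero_mul _]
      simp only [Function.leftInverse_invFun S.injective _]
    have hD0 : 0 ≤ expDistortion P d W := Finset.sum_nonneg fun x _ => Finset.sum_nonneg
      fun u _ => mul_nonneg (mul_nonneg (hP.1 x) ((hW x).1 u)) (hd x u)
    simp only [← Finset.sum_div]
    refine div_le_div_of_nonneg_right ?_ hlam.le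
    simp only [hdist, wordDistortion, ← mul_div_assoc, ← Finset.sum_div]
    rw [h1]
    -- An inequality, so that blocklength 0 needs no separate case.
    exact (div_le_of_le_mul₀ (Nat.cast_nonneg n) hD0 (mul_comm _ _).le).trans hD
  simp only [Covers, hQm] at hcov
  have hcov := hcov.trans (add_le_add hmean le_rfl)
  have hnonneg : 0 ≤ ∑ x, ∑ u, τ u * ((∏ t, Q (x t) (u t)) * dist x u / lam) :=
    Finset.sum_nonneg fun x _ => Finset.sum_nonneg fun u _ =>
      mul_nonneg (hτ u) (div_nonneg (mul_nonneg (hpr x u) (hdist0 x u)) hlam.le)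
  -- Arbitrary values of `invFun` off the image of `U` are harmless: `Q` vanishes there.
  have hsupp : ∀ (x : Fin n → X) u, τ u * ∏ t, Q (x t) (u t) ≠ 0 → u ∈ codebook C ∧
      ∀ t, S (Function.invFun S (u t)) = u t := by
    intro x u h
    refine ⟨hτC u (left_ne_zero_of_mul h), fun t => Function.invFun_eq ?_⟩
    by_contra hr
    exact Finset.prod_ne_zero_iff.mp (right_ne_zero_of_mul h) t (Finset.mem_univ t)
      (embeddedJoint_eq_zero hr)
  let W' := {w : Fin n → U // (fun t => S (w t)) ∈ codebook C}
  -- Without a codeword over `U` the deviation would be the full mass 1, exceeding `D / lam + η`.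
  have hne : Nonempty W' := by
    by_contra hempty
    have hzero : ∀ (x : Fin n → X) u, τ u * ∏ t, Q (x t) (u t) = 0 := by
      intro x u
      by_contra h
      obtain ⟨h1, h2⟩ := hsupp x u h
      refine hempty ⟨fun t => Function.invFun S (u t), ?_⟩
      simpa only [h2] using h1
    simp only [hzero, Finset.sum_const_zero, zero_sub, abs_neg,
      abs_of_nonneg (Finset.prod_nonneg fun t (_ : t ∈ Finset.univ) => hP.1 _)] at hcov
    rw [sum_pi_prod fun _ x => P x, hP.2, Finset.prod_const_one] at hcov
    linarith
  have hmin : ∀ x : Fin n → X, ∃ w : W', ∀ w' : W',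
      wordDistortion d x w.1 ≤ wordDistortion d x w'.1 := fun x =>
    Finite.exists_min fun w : W' => wordDistortion d x w.1
  choose e he using hmin
  refine ⟨⟨C, fun x => ⟨fun t => S ((e x).1 t), (e x).2⟩,
    fun w t => Function.invFun S (w.1 t), fun x t => ?_⟩, rfl, ?_⟩
  · simp only [Function.leftInverse_invFun S.injective _]
  -- Mass of `x` that is covered pays at most the weighted distortion, since the encoder is optimal;
  -- uncovered mass pays at most `lam`.
  have hkey : ∀ x : Fin n → X, (∏ t, P (x t)) * wordDistortion d x (e x).1 ≤
      lam * (∑ u, τ u * ((∏ t, Q (x t) (u t)) * dist x u / lam) +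
        |∑ u, τ u * ∏ t, Q (x t) (u t) - ∏ t, P (x t)|) := by
    intro x
    set δ := wordDistortion d x (e x).1 with hδ
    have hδ0 : 0 ≤ δ := wordDistortion_nonneg hd _ _
    have hδl : δ ≤ lam := wordDistortion_le hlam.le hdlam _ _
    have h1 : (∑ u, τ u * ∏ t, Q (x t) (u t)) * δ ≤
        lam * ∑ u, τ u * ((∏ t, Q (x t) (u t)) * dist x u / lam) := by
      rw [Finset.sum_mul, Finset.mul_sum]
      refine Finset.sum_le_sum fun u _ => ?_
      have h2 : lam * (τ u * ((∏ t, Q (x t) (u t)) * dist x u / lam)) =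
          τ u * (∏ t, Q (x t) (u t)) * dist x u := by
        field_simp
      rw [h2]
      by_cases h : τ u * ∏ t, Q (x t) (u t) = 0
      · rw [h, zero_mul, zero_mul]
      · obtain ⟨h3, h4⟩ := hsupp x u h
        refine mul_le_mul_of_nonneg_left ?_ (mul_nonneg (hτ u) (hpr x u))
        exact he x ⟨fun t => Function.invFun S (u t), by simpa only [h4] using h3⟩
    have h5 := mul_le_mul_of_nonneg_right hδl
      (abs_nonneg (∑ u, τ u * ∏ t, Q (x t) (u t) - ∏ t, P (x t)))
    have h6 := mul_le_mul_of_nonneg_left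
      (neg_abs_le (∑ u, τ u * ∏ t, Q (x t) (u t) - ∏ t, P (x t))) hδ0
    linarith
  calc ∑ x : Fin n → X, (∏ t, P (x t)) *
        ((∑ t, d (x t) (Function.invFun S (S ((e x).1 t)))) / n)
      = ∑ x : Fin n → X, (∏ t, P (x t)) * wordDistortion d x (e x).1 := by
        simp only [Function.leftInverse_invFun S.injective _, wordDistortion]
    _ ≤ lam * (D / lam + η) := by
        refine (Finset.sum_le_sum fun x _ => hkey x).trans ?_
        rw [← Finset.mul_sum, Finset.sum_add_distrib]
        exact mul_le_mul_of_nonneg_left hcov hlam.le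
    _ = D + lam * η := by
        field_simp

theorem achievable_of_admissible {k : ℕ} {p : Fin k → ℕ} (hp : ∀ i, (p i).Prime)
    (S : U ↪ (∀ i, ZMod (p i))) {P : X → ℝ} (hP : P ∈ stdSimplex ℝ X) {d : X → U → ℝ}
    (hd : ∀ x u, 0 ≤ d x u) {D R : ℝ} {W : X → U → ℝ} (hW : W ∈ admissible P d D)
    (hR : groupRate p P W ≤ R) : Achievable S P d R D := by
  intro ε hε
  have : ∀ i, Fact (p i).Prime := fun i => ⟨hp i⟩
  have hX : Nonempty X := by
    by_contra h
    rw [not_nonempty_iff] at h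
    simpa using hP.2
  have hU : Nonempty U := by
    by_contra h
    rw [not_nonempty_iff] at h
    simpa using (hW.1 hX.some).2
  have hD : 0 ≤ D := le_trans (Finset.sum_nonneg fun x _ => Finset.sum_nonneg
      fun u _ => mul_nonneg (mul_nonneg (hP.1 x) ((hW.1 x).1 u)) (hd x u)) hW.2
  -- Large enough to dominate `d` and to give `D / lam ≤ 1/2`; with `η ≤ 1/4` the nonemptiness
  -- condition holds.
  set lam := ∑ x, ∑ u, d x u + 2 * D + 1 with hlam
  have hsum : 0 ≤ ∑ x, ∑ u, d x u :=
    Finset.sum_nonneg fun x _ => Finset.sum_nonneg fun u _ => hd x u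
  have hlam0 : 0 < lam := by linarith
  have hdlam : ∀ x u, d x u ≤ lam := by
    intro x u
    have h1 := Finset.single_le_sum (fun u _ => hd x u) (Finset.mem_univ u)
    have h2 := Finset.single_le_sum (f := fun x => ∑ u, d x u)
      (fun x _ => Finset.sum_nonneg fun u _ => hd x u) (Finset.mem_univ x)
    linarith
  have hlog : 0 < Real.log 2 := Real.log_pos one_lt_two
  set η := min (ε / lam) (1 / 4) with hη
  have hη0 : 0 < η := lt_min (div_pos hε hlam0) (by norm_num)
  have hηε : lam * η ≤ ε := by
    have := mul_le_mul_of_nonneg_left (min_le_left (ε / lam) (1 / 4)) hlam0.le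
    rwa [mul_div_cancel₀ _ hlam0.ne'] at this
  have hDη : D / lam + η < 1 := by
    have h1 : D / lam ≤ 1 / 2 := by
      rw [div_le_iff₀ hlam0]
      linarith
    have h2 : η ≤ 1 / 4 := min_le_right _ _
    linarith
  -- The slack is `ε * log 2` because coverings count in nats and rates in bits.
  obtain ⟨N, hN⟩ := exists_group_covering p (Q := embeddedJoint S P W)
    (embeddedJoint_nonneg hP.1 fun x => (hW.1 x).1)
    (by simp only [sum_embeddedJoint fun x => (hW.1 x).2]; exact hP.2)
    (mul_pos hε hlog) hη0
  refine ⟨max N 1, fun n hn => ?_⟩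
  obtain ⟨C, τ, hτ, hτC, hC, hcov⟩ := hN n ((le_max_left _ _).trans hn) fun x u =>
    (∏ t, embeddedJoint S P W (x t) (u t)) *
      wordDistortion d x (fun t => Function.invFun S (u t)) / lam
  obtain ⟨c, hc, hcD⟩ := exists_groupScheme S hP hd hW.1 hW.2 hlam0 hdlam hDη hτ hτC hcov
  refine ⟨c, ?_, hcD.trans (by linarith)⟩
  have hn0 : (0 : ℝ) < n := by exact_mod_cast (le_max_right N 1).trans hn
  have hsumlog : ∑ i, Real.log (p i) = (∑ i, Real.logb 2 (p i)) * Real.log 2 := by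
    rw [Finset.sum_mul]
    exact Finset.sum_congr rfl fun i _ => (div_mul_cancel₀ _ hlog.ne').symm
  rw [GroupScheme.rate, hc, Real.logb, div_div, div_le_iff₀ (mul_pos hlog hn0)]
  rw [hsumlog, entropyDiff_embeddedJoint fun x => (hW.1 x).2] at hC
  refine hC.trans ?_
  have := mul_le_mul_of_nonneg_left hR (mul_pos hlog hn0).le
  unfold groupRate at this
  linarith

/-- The minimum of the group rate over the admissible test channels exists. -/
theorem exists_isLeast_groupRate {k : ℕ} (p : Fin k → ℕ) (P : X → ℝ) (d : X → U → ℝ) {D : ℝ}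
    (hD : (admissible P d D).Nonempty) :
    ∃ W ∈ admissible P d D, IsLeast (groupRate p P '' admissible P d D) (groupRate p P W) := by
  have hcompact : IsCompact (admissible P d D) := by
    have h1 : IsCompact (Set.pi Set.univ fun _ : X => stdSimplex ℝ U) :=
      isCompact_univ_pi fun _ => isCompact_stdSimplex ℝ U
    have h2 : IsClosed {W : X → U → ℝ | expDistortion P d W ≤ D} := by
      refine isClosed_le ?_ continuous_const
      unfold expDistortion
      fun_prop
    convert h1.inter_right h2 using 1
    ext W
    simp [admissible]
  have hcont : Continuous (groupRate p P : (X → U → ℝ) → ℝ) := by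
    unfold groupRate condEntropy
    have := Real.continuous_negMulLog
    fun_prop
  obtain ⟨W, hW, hmin⟩ := hcompact.exists_isMinOn hD hcont.continuousOn
  refine ⟨W, hW, ⟨W, hW, rfl⟩, ?_⟩
  rintro _ ⟨W', hW', rfl⟩
  exact hmin hW'

end Achievability

end GroupSourceCoding

theorem corollary3 {X U : Type*} [Fintype X] [Fintype U]
    (P : X → ℝ) (hP : P ∈ stdSimplex ℝ X)
    (d : X → U → ℝ) (hd : ∀ x u, 0 ≤ d x u)
    {k : ℕ} (p : Fin k → ℕ) (hp : ∀ i, (p i).Prime) (hcard : Fintype.card U ≤ ∏ i, p i)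
    (D : ℝ) (hD : (GroupSourceCoding.admissible P d D).Nonempty) :
    Nonempty (U ↪ (∀ i, ZMod (p i))) ∧
    ∃ R₀ : ℝ,
      IsLeast (GroupSourceCoding.groupRate p P '' GroupSourceCoding.admissible P d D) R₀ ∧
      ∀ S : U ↪ (∀ i, ZMod (p i)), ∀ R : ℝ, R₀ ≤ R →
        GroupSourceCoding.Achievable S P d R D := by
  constructor
  · have : ∀ i, NeZero (p i) := fun i => ⟨(hp i).ne_zero⟩
    refine Function.Embedding.nonempty_of_card_le ?_
    simpa only [Fintype.card_pi, ZMod.card] using hcard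
  · obtain ⟨W, hW, hmin⟩ := GroupSourceCoding.exists_isLeast_groupRate p P d hD
    exact ⟨_, hmin, fun S R hR =>
      GroupSourceCoding.achievable_of_admissible hp S hP hd hW hR⟩
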